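/- Let $\mathcal X,\mathcal A$ be finite sets, $N\ge 1$, $[N]=\{1,\dots,N\}$, let $p_n(\cdot|x,a)$ ($n\in[N]$) be probability vectors on $\mathcal X$ and let $\mu_0$ be a probability vector on $\mathcal X\times\mathcal A$. A policy is a family $\pi=(\pi_n(\cdot|x))_{n\in[N],\,x\in\mathcal X}$ of probability vectors on $\mathcal A$; it induces the state-action distributions $\mu^\pi=(\mu_n^\pi)_{0\le n\le N}$ with $\mu^\pi_0=\mu_0$ and $\mu^\pi_n(x',a')=\sum_{x,a}\mu^\pi_{n-1}(x,a)\,p_n(x'|x,a)\,\pi_n(a'|x')$. Let $f_n:\Delta_{\mathcal X\times\mathcal A}\to\mathbb R$ ($n\in[N]$) be convex and $\ell$-Lipschitz with respect to $\|\cdot\|_1$, with $\ell>0$, where $\Delta_{\mathcal X\times\mathcal A}$ is the probability simplex; put $F(\mu)=\sum_{n=1}^N f_n(\mu_n)$ and $L=\ell N$, and let $\pi^*$ minimize $F(\mu^\pi)$ over all policies. For policies $\pi,\pi'$ put $$\Gamma(\mu^\pi,\mu^{\pi'})=\sum_{n=1}^N\sum_{x,a}\mu_n^\pi(x,a)\log\frac{\pi_n(a|x)}{\pi_n'(a|x)}\qquad(0\log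 0=0).$$ Let $\pi^0$ be a policy such that $\mu^0=\mu^{\pi^0}$ is also induced by a policy all of whose probabilities $\pi_n(a|x)$ are non-zero. Let $K\ge 1$ and let $\pi^1,\dots,\pi^K$ be produced by $K$ iterations of MD-CURL: for $0\le k<K$, writing $\mu^k=\mu^{\pi^k}$, $$\pi^{k+1}_n(a|x)=\frac{\pi^k_n(a|x)\exp(\tau_k\tilde Q^k_n(x,a))}{\sum_{a'}\pi^k_n(a'|x)\exp(\tau_k\tilde Q^k_n(x,a'))},\qquad n\in[N],$$ where $\tilde Q^k_N(x,a)=-\nabla f_N(\mu^k_N)(x,a)$ and, for $1\le n<N$, $$\tilde Q^k_n(x,a)=\max_{\sigma\in(\Delta_{\mathcal A})^{\mathcal X}}\Big\{-\nabla f_n(\mu_n^k)(x,a)+\sum_{x'}p_{n+1}(x'|x,a)\sum_{a'}\sigma(a'|x')\Big[-\frac1{\tau_k}\log\frac{\sigma(a'|x')}{\pi^k_{n+1}(a'|x')}+\tilde Q^k_{n+1}(x',a')\Big]\Big\},$$ the gradients $\nabla f_n(\mu^k_n)$ (derivatives within the simplex) being assumed to exist, and with the step sizes $$\tau_k=L^{-1}\sqrt{2\,\Gamma(\mu^{\pi^*},\mu^0)/K},\qquad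 0\le k<K$$ (if $\Gamma(\mu^{\pi^*},\mu^0)=0$, then $\tau_k=0$ and the update is read as $\pi^{k+1}=\pi^k$). Then $$\min_{0\le k\le K}F(\mu^{\pi^k})-F(\mu^{\pi^*})\le L\,\frac{\sqrt{2\,\Gamma(\mu^{\pi^*},\mu^0)}}{\sqrt K}.$$ -/

import Mathlib

namespace MDCURL

noncomputable section

variable {X A : Type*} [Fintype X] [Fintype A]

/-- `p n x a x'` stands for `p_n(x' | x, a)`, `n = 1, …, N`: each `p_n(· | x, a)` is a
probability vector. Values at other indices `n` are irrelevant. -/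
def IsKernel (N : ℕ) (p : ℕ → X → A → X → ℝ) : Prop :=
  ∀ n ∈ Finset.Icc 1 N, ∀ x a, p n x a ∈ stdSimplex ℝ X

/-- `π n x a` stands for `π_n(a | x)`, `n = 1, …, N`: each `π_n(· | x)` is a probability
vector. Values at other indices `n` are irrelevant. -/
def IsPolicy (N : ℕ) (π : ℕ → X → A → ℝ) : Prop :=
  ∀ n ∈ Finset.Icc 1 N, ∀ x, π n x ∈ stdSimplex ℝ A

/-- The state-action distributions `μ_n^π`, `n = 0, 1, …`, induced by the policy `π`. -/
def occ (p : ℕ → X → A → X → ℝ) (μ₀ : X × A → ℝ) (π : ℕ → X → A → ℝ) :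
    ℕ → X × A → ℝ
  | 0 => μ₀
  | n + 1 => fun y =>
      ∑ x, ∑ a, occ p μ₀ π n (x, a) * p (n + 1) x a y.1 * π (n + 1) y.1 y.2

/-- The set `M_{μ₀}` of sequences of state-action distributions that start at `μ₀` and
satisfy the Bellman flow. -/
def flowSet (N : ℕ) (p : ℕ → X → A → X → ℝ) (μ₀ : X × A → ℝ) : Set (ℕ → X × A → ℝ) :=
  {μ | μ 0 = μ₀ ∧ ∀ n ∈ Finset.Icc 1 N, μ n ∈ stdSimplex ℝ (X × A) ∧
    ∀ x', ∑ a', μ n (x', a') = ∑ x, ∑ a, p n x a x' * μ (n - 1) (x, a)}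

/-- The subset `M*_{μ₀}` of those elements of `M_{μ₀}` that are induced by a policy which gives
every action positive probability in every state. (At a state which has mass zero the
policy inducing a given `μ` is arbitrary, whence the existential quantifier.) -/
def flowSetPos (N : ℕ) (p : ℕ → X → A → X → ℝ) (μ₀ : X × A → ℝ) :
    Set (ℕ → X × A → ℝ) :=
  {μ | μ ∈ flowSet N p μ₀ ∧ ∃ π : ℕ → X → A → ℝ, IsPolicy N π ∧
    (∀ n ∈ Finset.Icc 1 N, ∀ x a, π n x a ≠ 0) ∧ ∀ n ≤ N, occ p μ₀ π n = μ n}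

/-- The objective `F(μ) = ∑_{n=1}^N f_n(μ_n)`. -/
def objective (N : ℕ) (f : ℕ → (X × A → ℝ) → ℝ) (μ : ℕ → X × A → ℝ) : ℝ :=
  ∑ n ∈ Finset.Icc 1 N, f n (μ n)

/-- The regularizer `Γ(μ^π, μ^π') = ∑_{n=1}^N E_{(x,a) ∼ μ_n^π} [log (π_n(a|x) / π'_n(a|x))]`. -/
def Gam (N : ℕ) (p : ℕ → X → A → X → ℝ) (μ₀ : X × A → ℝ) (π π' : ℕ → X → A → ℝ) : ℝ :=
  ∑ n ∈ Finset.Icc 1 N, ∑ x, ∑ a,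
    occ p μ₀ π n (x, a) * Real.log (π n x a / π' n x a)

/-- The norm `‖v‖₁`. -/
def l1 {ι : Type*} [Fintype ι] (v : ι → ℝ) : ℝ := ∑ y, |v y|

/-- The linear form `v ↦ ⟨g, v⟩`. -/
def pairing {ι : Type*} [Fintype ι] (g : ι → ℝ) : (ι → ℝ) →L[ℝ] ℝ :=
  ∑ y, g y • ContinuousLinearMap.proj (R := ℝ) y

/-- `g` is a gradient at `ν` of the function `f` on the probability simplex, that is,
`f ν' = f ν + ⟨g, ν' - ν⟩ + o(‖ν' - ν‖)` as `ν' → ν` within the simplex. (Such a `g` is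
unique up to adding a constant vector; a gradient of an extension of `f` to a
neighbourhood is one.) -/
def IsSimplexGradient {ι : Type*} [Fintype ι] (f : (ι → ℝ) → ℝ) (g : ι → ℝ) (ν : ι → ℝ) :
    Prop :=
  HasFDerivWithinAt f (pairing g) (stdSimplex ℝ ι) ν

/-- The regularized Q-function of one iteration with step size `τ` and current policy `π`,
`g n` being the gradient of `f_n` at `μ_n^π`:
`Q_N = - g_N`, and, for `n < N`, `Q_n(x,a)` is the maximum over `σ ∈ (Δ_A)^X` of
`- g_n(x,a) + ∑_{x'} p_{n+1}(x'|x,a) ∑_{a'} σ(a'|x')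
    [- (1/τ) log (σ(a'|x') / π_{n+1}(a'|x')) + Q_{n+1}(x',a')]`. -/
def regQ (N : ℕ) (p : ℕ → X → A → X → ℝ) (τ : ℝ) (π : ℕ → X → A → ℝ)
    (g : ℕ → X × A → ℝ) (n : ℕ) : X → A → ℝ :=
  if n < N then fun x a =>
    sSup ((fun σ : X → A → ℝ => - g n (x, a) + ∑ x', p (n + 1) x a x' * ∑ a', σ x' a' *
        (-(1 / τ) * Real.log (σ x' a' / π (n + 1) x' a') + regQ N p τ π g (n + 1) x' a')) ''
      {σ | ∀ x', σ x' ∈ stdSimplex ℝ A})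
  else fun x a => - g n (x, a)
termination_by N - n

/-- One iteration of MD-CURL: the new policy is proportional to
`π_n(a|x) exp (τ Q_n(x,a))`. -/
def mdStep (N : ℕ) (p : ℕ → X → A → X → ℝ) (τ : ℝ) (π : ℕ → X → A → ℝ)
    (g : ℕ → X × A → ℝ) : ℕ → X → A → ℝ :=
  fun n x a => π n x a * Real.exp (τ * regQ N p τ π g n x a) /
    ∑ a', π n x a' * Real.exp (τ * regQ N p τ π g n x a')

/-- The policies `π^0, π^1, …` produced by MD-CURL from the initial policy `π⁰` with step
sizes `τ_0, τ_1, …`, where `G n ν` is the gradient of `f_n` at `ν`. -/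
def iter (N : ℕ) (p : ℕ → X → A → X → ℝ) (μ₀ : X × A → ℝ)
    (G : ℕ → (X × A → ℝ) → X × A → ℝ) (τ : ℕ → ℝ) (π₀ : ℕ → X → A → ℝ) :
    ℕ → ℕ → X → A → ℝ
  | 0 => π₀
  | k + 1 =>
      mdStep N p (τ k) (iter N p μ₀ G τ π₀ k)
        (fun n => G n (occ p μ₀ (iter N p μ₀ G τ π₀ k) n))

end

end MDCURL

namespace MDCURL

/-! ### Relative entropy of finite families -/

/-! This is mirror descent with `Gam` in the role of the Bregman divergence, and three facts carry
it. Strong convexity (`l1_occ_sub_le`): `Gam` is the relative entropy of the path laws, so it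
dominates the relative entropy of each time marginal (log-sum inequality) and hence half the squared
ℓ¹ distance of the marginals (Pinsker). An exact three-point identity (`Gam_sub_Gam_mdStep`): by
Gibbs' variational principle the maximum defining `regQ` is a log-partition value V, so log(π'/π) =
τ(Q - V) for the updated policy π'. Tested against the flow of any policy ρ, this telescopes in
time, so Γ(ρ,π) - Γ(ρ,π') is τ times minus the pairing of the gradients with μ^ρ, up to a term
independent of ρ. Subtracting the case ρ = π' removes that term. Descent (`mul_objective_sub_le`):
convexity, the Lipschitz bound and Young's inequality give τ(F(μ^π) - F(μ^ρ)) ≤ Γ(ρ,π) - Γ(ρ,π') +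
τ²L²/2. Summing with ρ = π* telescopes, and the step size balances the two remaining terms. Because
log 0 = 0 and division by 0 is 0, these identities can fail where a policy vanishes. `IsExploring`,
which the update preserves, confines zeros to unreachable states, where every weight is zero. -/

lemma sub_le_mul_log_div {a b : ℝ} (ha : 0 ≤ a) (hb : 0 ≤ b) (hab : a ≠ 0 → b ≠ 0) :
    a - b ≤ a * Real.log (a / b) := by
  rcases ha.eq_or_lt with rfl | ha
  · simpa using hb
  have hb' : 0 < b := hb.lt_of_ne' (hab ha.ne')
  have h := mul_le_mul_of_nonneg_left (Real.one_sub_inv_le_log_of_pos (div_pos ha hb')) ha.le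
  have e : a * (1 - (a / b)⁻¹) = a - b := by field_simp
  linarith

/-- The relative entropy of nonnegative families of equal mass is nonnegative. -/
lemma sum_mul_log_div_nonneg {ι : Type*} [Fintype ι] {a b : ι → ℝ} (ha : ∀ i, 0 ≤ a i)
    (hb : ∀ i, 0 ≤ b i) (hab : ∀ i, a i ≠ 0 → b i ≠ 0) (hs : ∑ i, b i ≤ ∑ i, a i) :
    0 ≤ ∑ i, a i * Real.log (a i / b i) := by
  have h : ∑ i, (a i - b i) ≤ ∑ i, a i * Real.log (a i / b i) :=
    Finset.sum_le_sum fun i _ => sub_le_mul_log_div (ha i) (hb i) (hab i)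
  rw [Finset.sum_sub_distrib] at h
  linarith

/-- The log-sum inequality. -/
lemma log_sum_inequality {ι : Type*} [Fintype ι] {a b : ι → ℝ} (ha : ∀ i, 0 ≤ a i)
    (hb : ∀ i, 0 ≤ b i) (hab : ∀ i, a i ≠ 0 → b i ≠ 0) :
    (∑ i, a i) * Real.log ((∑ i, a i) / ∑ i, b i) ≤ ∑ i, a i * Real.log (a i / b i) := by
  set s := ∑ i, a i with hs
  set t := ∑ i, b i with ht
  have hs0 : 0 ≤ s := Finset.sum_nonneg fun i _ => ha i
  have ht0 : 0 ≤ t := Finset.sum_nonneg fun i _ => hb i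
  rcases hs0.eq_or_lt with h0 | hs'
  · have hz : ∀ i, a i = 0 := fun i =>
      (Finset.sum_eq_zero_iff_of_nonneg fun i _ => ha i).1 (hs.symm.trans h0.symm) i
        (Finset.mem_univ i)
    simp [← h0, hz]
  have ht' : 0 < t := by
    refine ht0.lt_of_ne' fun h => ?_
    have hz : ∀ i, b i = 0 := fun i =>
      (Finset.sum_eq_zero_iff_of_nonneg fun i _ => hb i).1 (ht.symm.trans h) i (Finset.mem_univ i)
    have : s = 0 := Finset.sum_eq_zero fun i _ => by_contra fun h => hab i h (hz i)
    exact hs'.ne' this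
  have hst : 0 < s / t := div_pos hs' ht'
  -- Rescaling `b` to the mass of `a` reduces the claim to nonnegativity of relative entropy.
  have key := sum_mul_log_div_nonneg (a := a) (b := fun i => b i * (s / t)) ha
    (fun i => mul_nonneg (hb i) hst.le) (fun i h => mul_ne_zero (hab i h) hst.ne')
    (by rw [← Finset.sum_mul, ← ht]; exact le_of_eq (by rw [mul_div_cancel₀ _ ht'.ne']))
  have e : ∀ i, a i * Real.log (a i / (b i * (s / t)))
      = a i * Real.log (a i / b i) - a i * Real.log (s / t) := by
    intro i
    by_cases h : a i = 0
    · simp [h]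
    · rw [← div_div, Real.log_div (div_ne_zero h (hab i h)) hst.ne']
      ring
  simp only [e, Finset.sum_sub_distrib, ← Finset.sum_mul] at key
  linarith

/-- The difference `h` of the two sides vanishes at 1 and has derivative `4 * k`. Since `k` is
increasing, by log x ≥ 1 - 1/x, and vanishes at 1, `h` has its minimum there. -/
lemma three_mul_sub_one_sq_le {u : ℝ} (hu : 0 < u) :
    3 * (u - 1) ^ 2 ≤ (2 * u + 4) * (u * Real.log u - u + 1) := by
  set k : ℝ → ℝ := fun u => (u + 1) * Real.log u - 2 * (u - 1) with hk
  set h : ℝ → ℝ := fun u => (2 * u + 4) * (u * Real.log u - u + 1) - 3 * (u - 1) ^ 2 with hh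
  have dk : ∀ x, 0 < x → HasDerivAt k (Real.log x - (1 - x⁻¹)) x := fun x hx => by
    have := (((hasDerivAt_id x).add_const 1).mul (Real.hasDerivAt_log hx.ne')).sub
      (((hasDerivAt_id x).sub_const 1).const_mul 2)
    refine HasDerivAt.congr_deriv (f := k) this ?_
    simp only [id]
    field_simp
    ring
  have dh : ∀ x, 0 < x → HasDerivAt h (4 * k x) x := fun x hx => by
    have := ((((hasDerivAt_id x).const_mul 2).add_const 4).mul
      ((((hasDerivAt_id x).mul (Real.hasDerivAt_log hx.ne')).sub (hasDerivAt_id x)).add_const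
        1)).sub ((((hasDerivAt_id x).sub_const 1).pow 2).const_mul 3)
    refine HasDerivAt.congr_deriv (f := h) this ?_
    simp only [Pi.sub_apply, Pi.mul_apply, id, hk]
    field_simp
    ring
  have mk : MonotoneOn k (Set.Ioi 0) := by
    refine monotoneOn_of_deriv_nonneg (convex_Ioi 0)
      (fun x hx => (dk x hx).continuousAt.continuousWithinAt)
      (fun x hx => (dk x (interior_subset hx)).differentiableAt.differentiableWithinAt)
      fun x hx => ?_
    have hx : 0 < x := interior_subset hx
    rw [(dk x hx).deriv]
    linarith [Real.one_sub_inv_le_log_of_pos hx]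
  have k1 : k 1 = 0 := by simp [hk]
  suffices hu0 : h 1 ≤ h u by
    have h1 : h 1 = 0 := by simp [hh]
    rw [h1] at hu0
    linarith
  rcases le_total 1 u with h1u | hu1
  · have mh : MonotoneOn h (Set.Ici 1) := by
      refine monotoneOn_of_deriv_nonneg (convex_Ici 1)
        (fun x hx => (dh x (one_pos.trans_le hx)).continuousAt.continuousWithinAt)
        (fun x hx => (dh x (one_pos.trans_le
          (interior_subset hx))).differentiableAt.differentiableWithinAt) fun x hx => ?_
      have hx : 1 ≤ x := interior_subset hx
      have hx0 : 0 < x := by linarith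
      rw [(dh x hx0).deriv]
      linarith [mk (Set.mem_Ioi.2 one_pos) (Set.mem_Ioi.2 hx0) hx]
    exact mh (Set.mem_Ici.2 le_rfl) h1u h1u
  · have mh : AntitoneOn h (Set.Ioc 0 1) := by
      refine antitoneOn_of_deriv_nonpos (convex_Ioc 0 1)
        (fun x hx => (dh x hx.1).continuousAt.continuousWithinAt)
        (fun x hx => (dh x
          (interior_subset hx).1).differentiableAt.differentiableWithinAt) fun x hx => ?_
      have hx := interior_subset hx
      rw [(dh x hx.1).deriv]
      linarith [mk (Set.mem_Ioi.2 hx.1) (Set.mem_Ioi.2 one_pos) hx.2]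
    exact mh ⟨hu, hu1⟩ ⟨one_pos, le_rfl⟩ hu1

/-- The previous inequality at u = a/b, multiplied by b². The weights 2a + 4b have total 6 for
probability vectors, which yields the sharp constant in Pinsker's inequality. -/
lemma three_mul_sub_sq_le {a b : ℝ} (ha : 0 ≤ a) (hb : 0 ≤ b) (hab : a ≠ 0 → b ≠ 0) :
    3 * (a - b) ^ 2 ≤ (2 * a + 4 * b) * (a * Real.log (a / b) - a + b) := by
  rcases ha.eq_or_lt with rfl | ha
  · simp; nlinarith [sq_nonneg b]
  have hb' : 0 < b := hb.lt_of_ne' (hab ha.ne')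
  have h := mul_le_mul_of_nonneg_left (three_mul_sub_one_sq_le (div_pos ha hb')) (sq_nonneg b)
  have e1 : b ^ 2 * (3 * (a / b - 1) ^ 2) = 3 * (a - b) ^ 2 := by field_simp
  have e2 : b ^ 2 * ((2 * (a / b) + 4) * (a / b * Real.log (a / b) - a / b + 1))
      = (2 * a + 4 * b) * (a * Real.log (a / b) - a + b) := by field_simp
  linarith

/-- Pinsker's inequality. -/
lemma l1_sub_sq_le {ι : Type*} [Fintype ι] {a b : ι → ℝ} (ha : a ∈ stdSimplex ℝ ι)
    (hb : b ∈ stdSimplex ℝ ι) (hab : ∀ i, a i ≠ 0 → b i ≠ 0) :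
    l1 (a - b) ^ 2 ≤ 2 * ∑ i, a i * Real.log (a i / b i) := by
  have h0 : ∀ i, 0 ≤ a i * Real.log (a i / b i) - a i + b i := fun i => by
    have := sub_le_mul_log_div (ha.1 i) (hb.1 i) (hab i)
    linarith
  have h1 : ∀ i, 0 ≤ (2 * a i + 4 * b i) / 3 := fun i => by
    have := ha.1 i
    have := hb.1 i
    positivity
  -- Cauchy–Schwarz with the weights (2a + 4b)/3, of total mass 2.
  have h := Finset.sum_sq_le_sum_mul_sum_of_sq_le_mul Finset.univ (r := fun i => |a i - b i|)
    (fun i _ => h1 i) (fun i _ => h0 i) (fun i _ => by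
      have := three_mul_sub_sq_le (ha.1 i) (hb.1 i) (hab i)
      rw [sq_abs]
      linarith)
  have e1 : ∑ i, (2 * a i + 4 * b i) / 3 = 2 := by
    rw [← Finset.sum_div, Finset.sum_add_distrib, ← Finset.mul_sum, ← Finset.mul_sum, ha.2, hb.2]
    norm_num
  have e2 : ∑ i, (a i * Real.log (a i / b i) - a i + b i) = ∑ i, a i * Real.log (a i / b i) := by
    rw [Finset.sum_add_distrib, Finset.sum_sub_distrib, ha.2, hb.2]
    ring
  rw [e1, e2] at h
  simpa [l1] using h

/-! ### Gradients on the simplex -/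

section Gradient

variable {ι : Type*} [Fintype ι] {f : (ι → ℝ) → ℝ} {g ν : ι → ℝ}

lemma pairing_apply (g v : ι → ℝ) : pairing g v = ∑ y, g y * v y := by
  simp [pairing]

lemma add_smul_sub_mem_stdSimplex {μ : ι → ℝ} (hν : ν ∈ stdSimplex ℝ ι) (hμ : μ ∈ stdSimplex ℝ ι)
    (j : ℕ) : ν + ((j : ℝ) + 1)⁻¹ • (μ - ν) ∈ stdSimplex ℝ ι :=
  (convex_stdSimplex ℝ ι).add_smul_sub_mem hν hμ
    ⟨by positivity, inv_le_one_of_one_le₀ (by linarith [j.cast_nonneg (α := ℝ)])⟩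

/-- The difference quotients of `f` along a segment of the simplex converge to the pairing with the
gradient. -/
lemma IsSimplexGradient.tendsto (hg : IsSimplexGradient f g ν) (hν : ν ∈ stdSimplex ℝ ι)
    {μ : ι → ℝ} (hμ : μ ∈ stdSimplex ℝ ι) :
    Filter.Tendsto
      (fun j : ℕ => ((j : ℝ) + 1) * (f (ν + ((j : ℝ) + 1)⁻¹ • (μ - ν)) - f ν))
      Filter.atTop (nhds (pairing g (μ - ν))) := by
  have hc : Filter.Tendsto (fun j : ℕ => (j : ℝ) + 1) Filter.atTop Filter.atTop :=
    Filter.tendsto_atTop_add_const_right _ _ tendsto_natCast_atTop_atTop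
  refine HasFDerivWithinAt.lim hg ?_
    (Filter.Eventually.of_forall fun j => add_smul_sub_mem_stdSimplex hν hμ j)
    (tendsto_const_nhds.congr fun j => ?_)
  · simpa using hc.inv_tendsto_atTop.smul_const (μ - ν)
  · rw [smul_inv_smul₀ (by positivity)]

lemma IsSimplexGradient.le_sub (hg : IsSimplexGradient f g ν)
    (hf : ConvexOn ℝ (stdSimplex ℝ ι) f) (hν : ν ∈ stdSimplex ℝ ι)
    {μ : ι → ℝ} (hμ : μ ∈ stdSimplex ℝ ι) : pairing g (μ - ν) ≤ f μ - f ν := by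
  refine le_of_tendsto (hg.tendsto hν hμ) (Filter.Eventually.of_forall fun j => ?_)
  have hj : (0 : ℝ) < (j : ℝ) + 1 := by positivity
  have hj1 : ((j : ℝ) + 1)⁻¹ ≤ 1 := inv_le_one_of_one_le₀ (by linarith [j.cast_nonneg (α := ℝ)])
  have h := hf.2 hν hμ (sub_nonneg.2 hj1) (inv_nonneg.2 hj.le) (by ring)
  have e : (1 - ((j : ℝ) + 1)⁻¹) • ν + ((j : ℝ) + 1)⁻¹ • μ
      = ν + ((j : ℝ) + 1)⁻¹ • (μ - ν) := by module
  rw [e, smul_eq_mul, smul_eq_mul] at h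
  calc ((j : ℝ) + 1) * (f (ν + ((j : ℝ) + 1)⁻¹ • (μ - ν)) - f ν)
      ≤ ((j : ℝ) + 1) * (((j : ℝ) + 1)⁻¹ * (f μ - f ν)) := by gcongr; linarith
    _ = f μ - f ν := by field_simp

lemma l1_smul (c : ℝ) (v : ι → ℝ) : l1 (c • v) = |c| * l1 v := by
  simp [l1, abs_mul, Finset.mul_sum]

/-- Compare the difference quotients at ν towards μ and towards μ': the two moved points differ by
exactly (μ - μ')/(j+1). No bound on `g` itself is available, since it is determined only up to a
constant vector. -/
lemma IsSimplexGradient.pairing_le (hg : IsSimplexGradient f g ν) {ℓ : ℝ}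
    (hlip : ∀ ν ∈ stdSimplex ℝ ι, ∀ ν' ∈ stdSimplex ℝ ι, |f ν - f ν'| ≤ ℓ * l1 (ν - ν'))
    (hν : ν ∈ stdSimplex ℝ ι) {μ μ' : ι → ℝ} (hμ : μ ∈ stdSimplex ℝ ι)
    (hμ' : μ' ∈ stdSimplex ℝ ι) : pairing g (μ - μ') ≤ ℓ * l1 (μ - μ') := by
  have h := (hg.tendsto hν hμ).sub (hg.tendsto hν hμ')
  rw [← map_sub, sub_sub_sub_cancel_right] at h
  refine le_of_tendsto h (Filter.Eventually.of_forall fun j => ?_)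
  have hj : (0 : ℝ) < (j : ℝ) + 1 := by positivity
  have hl := (le_abs_self _).trans (hlip _ (add_smul_sub_mem_stdSimplex hν hμ j) _
    (add_smul_sub_mem_stdSimplex hν hμ' j))
  have e : ν + ((j : ℝ) + 1)⁻¹ • (μ - ν) - (ν + ((j : ℝ) + 1)⁻¹ • (μ' - ν))
      = ((j : ℝ) + 1)⁻¹ • (μ - μ') := by module
  rw [e, l1_smul, abs_of_pos (inv_pos.2 hj)] at hl
  calc _ = ((j : ℝ) + 1) * (f (ν + ((j : ℝ) + 1)⁻¹ • (μ - ν))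
          - f (ν + ((j : ℝ) + 1)⁻¹ • (μ' - ν))) := by ring
    _ ≤ ((j : ℝ) + 1) * (ℓ * (((j : ℝ) + 1)⁻¹ * l1 (μ - μ'))) := by gcongr
    _ = ℓ * l1 (μ - μ') := by field_simp

end Gradient

/-! ### State-action distributions of policies -/

section Occupation

variable {X A : Type*} [Fintype X] [Fintype A] {N : ℕ} {p : ℕ → X → A → X → ℝ} {μ₀ : X × A → ℝ}
  {π π' : ℕ → X → A → ℝ}

lemma occ_succ (n : ℕ) (y : X × A) : occ p μ₀ π (n + 1) y =
    (∑ z, occ p μ₀ π n z * p (n + 1) z.1 z.2 y.1) * π (n + 1) y.1 y.2 := by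
  rw [Fintype.sum_prod_type, occ, Finset.sum_mul]
  simp_rw [Finset.sum_mul]

/-- The Bellman flow tested against a function of the state alone: the action probabilities sum out,
so the right side involves the policy only up to time n. -/
lemma sum_occ_succ (hπ : IsPolicy N π) {n : ℕ} (hn : n < N) (V : X → ℝ) :
    ∑ y, occ p μ₀ π (n + 1) y * V y.1 =
      ∑ z, occ p μ₀ π n z * ∑ x', p (n + 1) z.1 z.2 x' * V x' := by
  have hs : ∀ x, ∑ a, π (n + 1) x a = 1 := fun x =>
    (hπ (n + 1) (Finset.mem_Icc.2 ⟨by omega, hn⟩) x).2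
  simp_rw [occ_succ, Fintype.sum_prod_type (γ := ℝ) (f := fun y : X × A => _ * V y.1)]
  calc _ = ∑ x', ∑ z, occ p μ₀ π n z * (p (n + 1) z.1 z.2 x' * V x') := by
        refine Finset.sum_congr rfl fun x' _ => ?_
        rw [← Finset.sum_mul, ← Finset.mul_sum, hs, mul_one, Finset.sum_mul]
        simp_rw [mul_assoc]
    _ = _ := by
        rw [Finset.sum_comm]
        simp_rw [Finset.mul_sum]

lemma occ_mem_stdSimplex (hp : IsKernel N p) (hμ₀ : μ₀ ∈ stdSimplex ℝ (X × A))
    (hπ : IsPolicy N π) : ∀ {n : ℕ}, n ≤ N → occ p μ₀ π n ∈ stdSimplex ℝ (X × A)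
  | 0, _ => hμ₀
  | n + 1, hn => by
    have ih := occ_mem_stdSimplex hp hμ₀ hπ (n := n) (by omega)
    have hm : n + 1 ∈ Finset.Icc 1 N := Finset.mem_Icc.2 ⟨by omega, hn⟩
    constructor
    · intro y
      rw [occ_succ]
      exact mul_nonneg (Finset.sum_nonneg fun z _ =>
        mul_nonneg (ih.1 z) ((hp _ hm z.1 z.2).1 y.1)) ((hπ _ hm y.1).1 y.2)
    · have h := sum_occ_succ (p := p) (μ₀ := μ₀) hπ (n := n) (by omega) (fun _ => 1)
      simpa [(hp _ hm _ _).2, ih.2] using h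

/-- A policy that has positive probabilities on the support of another one reaches everything
that the latter reaches. -/
lemma occ_ne_zero_of_occ_ne_zero (hp : IsKernel N p) (hμ₀ : μ₀ ∈ stdSimplex ℝ (X × A))
    (hπ : IsPolicy N π) (hπ' : IsPolicy N π')
    (hs : ∀ n ∈ Finset.Icc 1 N, ∀ y, occ p μ₀ π n y ≠ 0 → π' n y.1 y.2 ≠ 0) :
    ∀ {n : ℕ}, n ≤ N → ∀ y, occ p μ₀ π n y ≠ 0 → occ p μ₀ π' n y ≠ 0
  | 0, _ => fun _ h => h
  | n + 1, hn => fun y h => by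
    have ih := occ_ne_zero_of_occ_ne_zero hp hμ₀ hπ hπ' hs (n := n) (by omega)
    have hm : n + 1 ∈ Finset.Icc 1 N := Finset.mem_Icc.2 ⟨by omega, hn⟩
    have hπy := hs _ hm y h
    rw [occ_succ] at h ⊢
    refine mul_ne_zero ?_ hπy
    obtain ⟨z, -, hz⟩ := Finset.exists_ne_zero_of_sum_ne_zero (left_ne_zero_of_mul h)
    have hpos : 0 < occ p μ₀ π' n z * p (n + 1) z.1 z.2 y.1 :=
      (mul_nonneg ((occ_mem_stdSimplex hp hμ₀ hπ' (by omega)).1 z)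
        ((hp _ hm z.1 z.2).1 y.1)).lt_of_ne'
        (mul_ne_zero (ih z (left_ne_zero_of_mul hz)) (right_ne_zero_of_mul hz))
    exact (hpos.trans_le (Finset.single_le_sum (fun w _ =>
      mul_nonneg ((occ_mem_stdSimplex hp hμ₀ hπ' (by omega)).1 w)
        ((hp _ hm w.1 w.2).1 y.1)) (Finset.mem_univ z))).ne'

/-- `Gam` as a sum over state-action pairs. -/
lemma Gam_eq : Gam N p μ₀ π π' = ∑ n ∈ Finset.Icc 1 N, ∑ y : X × A,
    occ p μ₀ π n y * Real.log (π n y.1 y.2 / π' n y.1 y.2) := by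
  simp [Gam, Fintype.sum_prod_type]

/-- The log-sum inequality over the predecessors z of y. The transition probabilities cancel in the
ratio, whose logarithm splits into the part from time n and the part from the new action. -/
lemma occ_succ_mul_log_le (hp : IsKernel N p) (hμ₀ : μ₀ ∈ stdSimplex ℝ (X × A))
    (hπ : IsPolicy N π) (hπ' : IsPolicy N π')
    (hs : ∀ n ∈ Finset.Icc 1 N, ∀ y, occ p μ₀ π n y ≠ 0 → π' n y.1 y.2 ≠ 0)
    {n : ℕ} (hn : n < N) (y : X × A) :
    occ p μ₀ π (n + 1) y * Real.log (occ p μ₀ π (n + 1) y / occ p μ₀ π' (n + 1) y) ≤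
      ∑ z, occ p μ₀ π n z * p (n + 1) z.1 z.2 y.1 * π (n + 1) y.1 y.2 *
        Real.log (occ p μ₀ π n z / occ p μ₀ π' n z) +
      occ p μ₀ π (n + 1) y * Real.log (π (n + 1) y.1 y.2 / π' (n + 1) y.1 y.2) := by
  have hm : n + 1 ∈ Finset.Icc 1 N := Finset.mem_Icc.2 ⟨by omega, hn⟩
  have h0 := (occ_mem_stdSimplex (n := n) hp hμ₀ hπ (by omega)).1
  have h0' := (occ_mem_stdSimplex (n := n) hp hμ₀ hπ' (by omega)).1
  have hsupp := occ_ne_zero_of_occ_ne_zero hp hμ₀ hπ hπ' hs (n := n) hn.le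
  by_cases hy : occ p μ₀ π (n + 1) y = 0
  · have hz : ∀ z, occ p μ₀ π n z * p (n + 1) z.1 z.2 y.1 * π (n + 1) y.1 y.2 = 0 := by
      have : ∑ z, occ p μ₀ π n z * p (n + 1) z.1 z.2 y.1 * π (n + 1) y.1 y.2 = 0 := by
        rw [← Finset.sum_mul, ← occ_succ, hy]
      exact fun z => (Finset.sum_eq_zero_iff_of_nonneg fun z _ =>
        mul_nonneg (mul_nonneg (h0 z) ((hp _ hm z.1 z.2).1 y.1)) ((hπ _ hm y.1).1 y.2)).1 this z
        (Finset.mem_univ z)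
    simp [hy, hz]
  have hπ'y := hs _ hm y hy
  have hπy : π (n + 1) y.1 y.2 ≠ 0 := by
    rw [occ_succ] at hy
    exact right_ne_zero_of_mul hy
  have h := log_sum_inequality
    (a := fun z => occ p μ₀ π n z * p (n + 1) z.1 z.2 y.1 * π (n + 1) y.1 y.2)
    (b := fun z => occ p μ₀ π' n z * p (n + 1) z.1 z.2 y.1 * π' (n + 1) y.1 y.2)
    (fun z => mul_nonneg (mul_nonneg (h0 z) ((hp _ hm z.1 z.2).1 y.1)) ((hπ _ hm y.1).1 y.2))
    (fun z => mul_nonneg (mul_nonneg (h0' z) ((hp _ hm z.1 z.2).1 y.1)) ((hπ' _ hm y.1).1 y.2))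
    (fun z hz => mul_ne_zero (mul_ne_zero
      (hsupp z (left_ne_zero_of_mul (left_ne_zero_of_mul hz)))
      (right_ne_zero_of_mul (left_ne_zero_of_mul hz))) hπ'y)
  simp only [← Finset.sum_mul, ← occ_succ] at h
  refine h.trans (le_of_eq ?_)
  rw [occ_succ, Finset.sum_mul, Finset.sum_mul, ← Finset.sum_add_distrib]
  refine Finset.sum_congr rfl fun z _ => ?_
  by_cases hz : occ p μ₀ π n z * p (n + 1) z.1 z.2 y.1 = 0
  · simp [hz]
  have hz1 := left_ne_zero_of_mul hz
  have hz2 := right_ne_zero_of_mul hz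
  have e : occ p μ₀ π n z * p (n + 1) z.1 z.2 y.1 * π (n + 1) y.1 y.2 /
      (occ p μ₀ π' n z * p (n + 1) z.1 z.2 y.1 * π' (n + 1) y.1 y.2) =
      (occ p μ₀ π n z / occ p μ₀ π' n z) * (π (n + 1) y.1 y.2 / π' (n + 1) y.1 y.2) := by
    have := hsupp z hz1
    field_simp
  rw [e, Real.log_mul (div_ne_zero hz1 (hsupp z hz1)) (div_ne_zero hπy hπ'y)]
  ring

/-- The relative entropy of the state-action distributions at time `n` is bounded by that of the
paths up to time `n`. -/
lemma sum_occ_mul_log_le_Gam (hp : IsKernel N p) (hμ₀ : μ₀ ∈ stdSimplex ℝ (X × A))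
    (hπ : IsPolicy N π) (hπ' : IsPolicy N π')
    (hs : ∀ n ∈ Finset.Icc 1 N, ∀ y, occ p μ₀ π n y ≠ 0 → π' n y.1 y.2 ≠ 0) :
    ∀ {n : ℕ}, n ≤ N →
      ∑ y, occ p μ₀ π n y * Real.log (occ p μ₀ π n y / occ p μ₀ π' n y) ≤ Gam n p μ₀ π π'
  | 0, _ => by
    refine le_of_eq ?_
    simp only [Gam, occ]
    refine Finset.sum_eq_zero fun y _ => ?_
    by_cases h : μ₀ y = 0 <;> simp [h]
  | n + 1, hn => by
    have ih := sum_occ_mul_log_le_Gam hp hμ₀ hπ hπ' hs (n := n) (by omega)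
    have hm : n + 1 ∈ Finset.Icc 1 N := Finset.mem_Icc.2 ⟨by omega, hn⟩
    have h := Finset.sum_le_sum fun y (_ : y ∈ Finset.univ) =>
      occ_succ_mul_log_le hp hμ₀ hπ hπ' hs hn y
    rw [Finset.sum_add_distrib] at h
    have e : ∑ y : X × A, ∑ z, occ p μ₀ π n z * p (n + 1) z.1 z.2 y.1 * π (n + 1) y.1 y.2 *
        Real.log (occ p μ₀ π n z / occ p μ₀ π' n z) =
        ∑ z, occ p μ₀ π n z * Real.log (occ p μ₀ π n z / occ p μ₀ π' n z) := by
      rw [Finset.sum_comm]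
      refine Finset.sum_congr rfl fun z _ => ?_
      have h1 : ∑ y : X × A, p (n + 1) z.1 z.2 y.1 * π (n + 1) y.1 y.2 = 1 := by
        simp_rw [Fintype.sum_prod_type, ← Finset.mul_sum, (hπ _ hm _).2, mul_one]
        exact (hp _ hm z.1 z.2).2
      calc _ = ∑ y : X × A, (occ p μ₀ π n z * Real.log (occ p μ₀ π n z / occ p μ₀ π' n z)) *
            (p (n + 1) z.1 z.2 y.1 * π (n + 1) y.1 y.2) :=
              Finset.sum_congr rfl fun y _ => by ring
        _ = _ := by rw [← Finset.mul_sum, h1, mul_one]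
    rw [e] at h
    rw [Gam_eq, Finset.sum_Icc_succ_top (by omega), ← Gam_eq]
    linarith

/-- Given the state x, the inner sum over actions is the mass of x times the relative entropy of two
action distributions. -/
lemma sum_occ_mul_log_policy_nonneg (hp : IsKernel N p) (hμ₀ : μ₀ ∈ stdSimplex ℝ (X × A))
    (hπ : IsPolicy N π) (hπ' : IsPolicy N π')
    (hs : ∀ n ∈ Finset.Icc 1 N, ∀ y, occ p μ₀ π n y ≠ 0 → π' n y.1 y.2 ≠ 0)
    {n : ℕ} (hn : n ∈ Finset.Icc 1 N) :
    0 ≤ ∑ y : X × A, occ p μ₀ π n y * Real.log (π n y.1 y.2 / π' n y.1 y.2) := by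
  obtain ⟨h1, h2⟩ := Finset.mem_Icc.1 hn
  obtain ⟨n, rfl⟩ : ∃ m, n = m + 1 := ⟨n - 1, by omega⟩
  rw [Fintype.sum_prod_type]
  refine Finset.sum_nonneg fun x _ => ?_
  set c := ∑ z, occ p μ₀ π n z * p (n + 1) z.1 z.2 x with hc
  have hc0 : 0 ≤ c := Finset.sum_nonneg fun z _ =>
    mul_nonneg ((occ_mem_stdSimplex hp hμ₀ hπ (by omega)).1 z) ((hp _ hn z.1 z.2).1 x)
  simp_rw [occ_succ, ← hc, mul_assoc, ← Finset.mul_sum]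
  rcases hc0.eq_or_lt with h | h
  · simp [← h]
  refine mul_nonneg hc0 (sum_mul_log_div_nonneg (hπ _ hn x).1 (hπ' _ hn x).1 (fun a ha => ?_) ?_)
  · refine hs _ hn (x, a) ?_
    rw [occ_succ]
    exact mul_ne_zero h.ne' ha
  · rw [(hπ _ hn x).2, (hπ' _ hn x).2]

lemma Gam_mono (hp : IsKernel N p) (hμ₀ : μ₀ ∈ stdSimplex ℝ (X × A))
    (hπ : IsPolicy N π) (hπ' : IsPolicy N π')
    (hs : ∀ n ∈ Finset.Icc 1 N, ∀ y, occ p μ₀ π n y ≠ 0 → π' n y.1 y.2 ≠ 0)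
    {n : ℕ} (hn : n ≤ N) : Gam n p μ₀ π π' ≤ Gam N p μ₀ π π' := by
  rw [Gam_eq, Gam_eq]
  exact Finset.sum_le_sum_of_subset_of_nonneg (Finset.Icc_subset_Icc_right hn)
    fun m hm _ => sum_occ_mul_log_policy_nonneg hp hμ₀ hπ hπ' hs hm

lemma Gam_nonneg (hp : IsKernel N p) (hμ₀ : μ₀ ∈ stdSimplex ℝ (X × A))
    (hπ : IsPolicy N π) (hπ' : IsPolicy N π')
    (hs : ∀ n ∈ Finset.Icc 1 N, ∀ y, occ p μ₀ π n y ≠ 0 → π' n y.1 y.2 ≠ 0) :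
    0 ≤ Gam N p μ₀ π π' := by
  rw [Gam_eq]
  exact Finset.sum_nonneg fun m hm => sum_occ_mul_log_policy_nonneg hp hμ₀ hπ hπ' hs hm

/-- Strong convexity of `Gam`: the state-action distributions differ in `‖·‖₁` by at most
`√(2 Γ)`. -/
lemma l1_occ_sub_le (hp : IsKernel N p) (hμ₀ : μ₀ ∈ stdSimplex ℝ (X × A))
    (hπ : IsPolicy N π) (hπ' : IsPolicy N π')
    (hs : ∀ n ∈ Finset.Icc 1 N, ∀ y, occ p μ₀ π n y ≠ 0 → π' n y.1 y.2 ≠ 0)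
    {n : ℕ} (hn : n ≤ N) :
    l1 (occ p μ₀ π n - occ p μ₀ π' n) ≤ Real.sqrt (2 * Gam N p μ₀ π π') := by
  refine Real.le_sqrt_of_sq_le ?_
  have h1 := l1_sub_sq_le (occ_mem_stdSimplex hp hμ₀ hπ hn) (occ_mem_stdSimplex hp hμ₀ hπ' hn)
    (occ_ne_zero_of_occ_ne_zero hp hμ₀ hπ hπ' hs hn)
  have h2 := sum_occ_mul_log_le_Gam hp hμ₀ hπ hπ' hs hn
  have h3 := Gam_mono hp hμ₀ hπ hπ' hs hn
  linarith

end Occupation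

/-! ### One step of MD-CURL -/

section Step

variable {X A : Type*} [Fintype X] [Fintype A] {N : ℕ} {p : ℕ → X → A → X → ℝ} {μ₀ : X × A → ℝ}
  {π : ℕ → X → A → ℝ} {g : ℕ → X × A → ℝ} {τ : ℝ}

lemma sum_mul_exp_pos {q : A → ℝ} (hq : q ∈ stdSimplex ℝ A) (Q : A → ℝ) :
    0 < ∑ a, q a * Real.exp (Q a) := by
  have h : 0 < ∑ a, q a := by rw [hq.2]; exact one_pos
  obtain ⟨a, ha, h0⟩ := Finset.exists_ne_zero_of_sum_ne_zero h.ne'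
  exact Finset.sum_pos' (fun b _ => mul_nonneg (hq.1 b) (Real.exp_pos _).le)
    ⟨a, ha, mul_pos ((hq.1 a).lt_of_ne' h0) (Real.exp_pos _)⟩

lemma tilt_mem_stdSimplex {q : A → ℝ} (hq : q ∈ stdSimplex ℝ A) (Q : A → ℝ) :
    (fun a => q a * Real.exp (Q a) / ∑ b, q b * Real.exp (Q b)) ∈ stdSimplex ℝ A := by
  have h := sum_mul_exp_pos hq Q
  refine ⟨fun a => div_nonneg (mul_nonneg (hq.1 a) (Real.exp_pos _).le) h.le, ?_⟩
  rw [← Finset.sum_div, div_self h.ne']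

lemma log_tilt_div {q : A → ℝ} (hq : q ∈ stdSimplex ℝ A) (Q : A → ℝ) {a : A} (ha : q a ≠ 0) :
    Real.log (q a * Real.exp (Q a) / (∑ b, q b * Real.exp (Q b)) / q a) =
      Q a - Real.log (∑ b, q b * Real.exp (Q b)) := by
  have h := sum_mul_exp_pos hq Q
  have e : q a * Real.exp (Q a) / (∑ b, q b * Real.exp (Q b)) / q a =
      Real.exp (Q a) / ∑ b, q b * Real.exp (Q b) := by field_simp
  rw [e, Real.log_div (Real.exp_pos _).ne' h.ne', Real.log_exp]

/-- The Gibbs variational principle: upper bound. -/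
lemma sum_mul_le_log_sum_exp {q σ : A → ℝ} (hq : q ∈ stdSimplex ℝ A) (hq0 : ∀ a, q a ≠ 0)
    (hσ : σ ∈ stdSimplex ℝ A) (Q : A → ℝ) (hτ : 0 < τ) :
    ∑ a, σ a * (-(1 / τ) * Real.log (σ a / q a) + Q a) ≤
      1 / τ * Real.log (∑ a, q a * Real.exp (τ * Q a)) := by
  have hw := tilt_mem_stdSimplex hq fun a => τ * Q a
  have hZ := sum_mul_exp_pos hq fun a => τ * Q a
  -- The gap between the two sides is 1/τ times the relative entropy of σ with respect to the tilted
  -- distribution.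
  have h := sum_mul_log_div_nonneg (a := σ) hσ.1 hw.1
    (fun a _ => div_ne_zero (mul_ne_zero (hq0 a) (Real.exp_pos _).ne') hZ.ne')
    (by rw [hw.2, hσ.2])
  have e : ∀ a, σ a * (-(1 / τ) * Real.log (σ a / q a) + Q a) =
      1 / τ * (σ a * Real.log (∑ a, q a * Real.exp (τ * Q a)) -
        σ a * Real.log (σ a / (q a * Real.exp (τ * Q a) / ∑ b, q b * Real.exp (τ * Q b)))) := by
    intro a
    by_cases ha : σ a = 0
    · simp [ha]
    have hd := log_tilt_div hq (fun a => τ * Q a) (hq0 a)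
    have hwa : q a * Real.exp (τ * Q a) / (∑ b, q b * Real.exp (τ * Q b)) ≠ 0 :=
      div_ne_zero (mul_ne_zero (hq0 a) (Real.exp_pos _).ne') hZ.ne'
    rw [Real.log_div hwa (hq0 a)] at hd
    rw [Real.log_div ha (hq0 a), Real.log_div ha hwa]
    rw [sub_eq_iff_eq_add] at hd
    rw [hd]
    field_simp
    ring
  simp_rw [e]
  rw [← Finset.mul_sum, Finset.sum_sub_distrib, ← Finset.sum_mul, hσ.2, one_mul]
  have := one_div_pos.2 hτ
  gcongr
  linarith

/-- The Gibbs variational principle: the maximizer. -/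
lemma sum_tilt_mul_eq_log_sum_exp {q : A → ℝ} (hq : q ∈ stdSimplex ℝ A) (hq0 : ∀ a, q a ≠ 0)
    (Q : A → ℝ) (hτ : 0 < τ) :
    ∑ a, q a * Real.exp (τ * Q a) / (∑ b, q b * Real.exp (τ * Q b)) *
      (-(1 / τ) * Real.log (q a * Real.exp (τ * Q a) / (∑ b, q b * Real.exp (τ * Q b)) / q a)
        + Q a) = 1 / τ * Real.log (∑ a, q a * Real.exp (τ * Q a)) := by
  -- At the tilted distribution the bracket does not depend on the action.
  have e : ∀ a, -(1 / τ) * Real.log (q a * Real.exp (τ * Q a) /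
      (∑ b, q b * Real.exp (τ * Q b)) / q a) + Q a =
      1 / τ * Real.log (∑ a, q a * Real.exp (τ * Q a)) := fun a => by
    rw [log_tilt_div hq (fun a => τ * Q a) (hq0 a)]
    field_simp
    ring
  simp_rw [e]
  rw [← Finset.sum_mul, (tilt_mem_stdSimplex hq fun a => τ * Q a).2, one_mul]

lemma IsPolicy.mdStep (hπ : IsPolicy N π) : IsPolicy N (mdStep N p τ π g) :=
  fun n hn x => tilt_mem_stdSimplex (hπ n hn x) fun a => τ * regQ N p τ π g n x a

lemma mdStep_ne_zero (hπ : IsPolicy N π) {n : ℕ} (hn : n ∈ Finset.Icc 1 N) {x : X} {a : A}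
    (h : π n x a ≠ 0) : mdStep N p τ π g n x a ≠ 0 :=
  div_ne_zero (mul_ne_zero h (Real.exp_pos _).ne')
    (sum_mul_exp_pos (hπ n hn x) fun a => τ * regQ N p τ π g n x a).ne'

/-- The regularized value function of one iteration. -/
noncomputable def regV (N : ℕ) (p : ℕ → X → A → X → ℝ) (τ : ℝ) (π : ℕ → X → A → ℝ)
    (g : ℕ → X × A → ℝ) (n : ℕ) (x : X) : ℝ :=
  if n ≤ N then 1 / τ * Real.log (∑ a, π n x a * Real.exp (τ * regQ N p τ π g n x a)) else 0

/-- The regularized Bellman equation. -/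
lemma regQ_eq (hp : IsKernel N p) (hπ : IsPolicy N π) (hτ : 0 < τ) {n : ℕ} (hn1 : 1 ≤ n)
    (hn : n ≤ N) {x : X} {a : A}
    (hpos : n < N → ∀ x', p (n + 1) x a x' ≠ 0 → ∀ a', π (n + 1) x' a' ≠ 0) :
    regQ N p τ π g n x a =
      - g n (x, a) + ∑ x', p (n + 1) x a x' * regV N p τ π g (n + 1) x' := by
  rcases hn.eq_or_lt with rfl | hlt
  · rw [regQ]
    simp [regV]
  have hm : n + 1 ∈ Finset.Icc 1 N := Finset.mem_Icc.2 ⟨by omega, hlt⟩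
  rw [regQ, if_pos hlt]
  -- The updated policy attains the maximum at all successors x' simultaneously. Successors with `p
  -- = 0` drop out; at the others `hpos` excludes log(σ/0), which would count as 0 instead of an
  -- infinite penalty.
  refine IsGreatest.csSup_eq ⟨⟨MDCURL.mdStep N p τ π g (n + 1), hπ.mdStep _ hm, ?_⟩, ?_⟩
  · refine congrArg _ (Finset.sum_congr rfl fun x' _ => ?_)
    by_cases h : p (n + 1) x a x' = 0
    · simp [h]
    rw [regV, if_pos (Nat.succ_le_of_lt hlt), ← sum_tilt_mul_eq_log_sum_exp (hπ _ hm x') (hpos hlt x' h) _ hτ]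
    rfl
  · rintro _ ⟨σ, hσ, rfl⟩
    refine add_le_add_right (Finset.sum_le_sum fun x' _ => ?_) _
    by_cases h : p (n + 1) x a x' = 0
    · simp [h]
    refine mul_le_mul_of_nonneg_left ?_ ((hp _ hm x a).1 x')
    rw [regV, if_pos (Nat.succ_le_of_lt hlt)]
    exact sum_mul_le_log_sum_exp (hπ _ hm x') (hpos hlt x' h) (hσ x') _ hτ

lemma sum_Icc_sub_succ (T : ℕ → ℝ) (N : ℕ) :
    ∑ n ∈ Finset.Icc 1 N, (T (n + 1) - T n) = T (N + 1) - T 1 := by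
  induction N with
  | zero => simp
  | succ N ih => rw [Finset.sum_Icc_succ_top (by omega), ih]; ring

/-- `π` has positive probabilities at all states that can be reached from `μ₀`. -/
structure IsExploring (N : ℕ) (p : ℕ → X → A → X → ℝ) (μ₀ : X × A → ℝ) (π : ℕ → X → A → ℝ) :
    Prop where
  isPolicy : IsPolicy N π
  ne_zero_of_occ_ne_zero : ∀ ρ, IsPolicy N ρ → ∀ n ∈ Finset.Icc 1 N, ∀ x a,
    occ p μ₀ ρ n (x, a) ≠ 0 → ∀ a', π n x a' ≠ 0

lemma IsExploring.mdStep (hπ : IsExploring N p μ₀ π) :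
    IsExploring N p μ₀ (mdStep N p τ π g) :=
  ⟨hπ.isPolicy.mdStep, fun ρ hρ n hn x a h a' =>
    mdStep_ne_zero hπ.isPolicy hn (hπ.ne_zero_of_occ_ne_zero ρ hρ n hn x a h a')⟩

lemma IsExploring.policy_ne_zero (hπ : IsExploring N p μ₀ π) {ρ : ℕ → X → A → ℝ}
    (hρ : IsPolicy N ρ) : ∀ n ∈ Finset.Icc 1 N, ∀ y, occ p μ₀ ρ n y ≠ 0 → π n y.1 y.2 ≠ 0 :=
  fun n hn y h => hπ.ne_zero_of_occ_ne_zero ρ hρ n hn y.1 y.2 h y.2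

/-- The positive policy reaches every reachable state with every action. As `π` induces the same
distributions, its own factor in that mass cannot vanish. -/
lemma isExploring_of_mem_flowSetPos (hp : IsKernel N p) (hμ₀ : μ₀ ∈ stdSimplex ℝ (X × A))
    (hπ : IsPolicy N π) (hpos : occ p μ₀ π ∈ flowSetPos N p μ₀) : IsExploring N p μ₀ π := by
  obtain ⟨-, π', hπ', hne, hocc⟩ := hpos
  refine ⟨hπ, fun ρ hρ n hn x a h a' => ?_⟩
  have h1 := occ_ne_zero_of_occ_ne_zero hp hμ₀ hρ hπ' (fun n hn y _ => hne n hn y.1 y.2)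
    (Finset.mem_Icc.1 hn).2 _ h
  obtain ⟨m, rfl⟩ : ∃ m, n = m + 1 := ⟨n - 1, by have := Finset.mem_Icc.1 hn; omega⟩
  have h2 : occ p μ₀ π' (m + 1) (x, a') ≠ 0 := by
    rw [occ_succ] at h1 ⊢
    exact mul_ne_zero (left_ne_zero_of_mul h1) (hne _ hn x a')
  rw [hocc _ (Finset.mem_Icc.1 hn).2, occ_succ] at h2
  exact right_ne_zero_of_mul h2

/-- From a state-action pair with positive mass, an exploring policy has positive probabilities
at all possible successors. -/
lemma IsExploring.ne_zero_of_transition (hp : IsKernel N p) (hμ₀ : μ₀ ∈ stdSimplex ℝ (X × A))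
    (hπ : IsExploring N p μ₀ π) {ρ : ℕ → X → A → ℝ} (hρ : IsPolicy N ρ) {n : ℕ} (hn : n < N)
    {x : X} {a : A} (h : occ p μ₀ ρ n (x, a) ≠ 0) {x' : X} (hx' : p (n + 1) x a x' ≠ 0) (a' : A) :
    π (n + 1) x' a' ≠ 0 := by
  have hm : n + 1 ∈ Finset.Icc 1 N := Finset.mem_Icc.2 ⟨by omega, hn⟩
  obtain ⟨b, -, hb⟩ := Finset.exists_ne_zero_of_sum_ne_zero
    (by rw [(hρ _ hm x').2]; exact one_ne_zero)
  refine hπ.ne_zero_of_occ_ne_zero ρ hρ _ hm x' b ?_ a'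
  rw [occ_succ]
  have h0 : ∀ z, 0 ≤ occ p μ₀ ρ n z * p (n + 1) z.1 z.2 x' := fun z =>
    mul_nonneg ((occ_mem_stdSimplex hp hμ₀ hρ hn.le).1 z) ((hp _ hm z.1 z.2).1 x')
  exact mul_ne_zero (((h0 (x, a)).lt_of_ne' (mul_ne_zero h hx')).trans_le
    (Finset.single_le_sum (fun z _ => h0 z) (Finset.mem_univ (x, a)))).ne' hb

/-- The log-ratio equals τ(Q - V); the Bellman equation expresses Q through the next V, and the flow
moves that term to time n + 1, leaving a difference that telescopes in n. -/
lemma sum_occ_mul_log_mdStep (hp : IsKernel N p) (hμ₀ : μ₀ ∈ stdSimplex ℝ (X × A))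
    (hπ : IsExploring N p μ₀ π) (hτ : 0 < τ) {ρ : ℕ → X → A → ℝ} (hρ : IsPolicy N ρ) {n : ℕ}
    (hn : n ∈ Finset.Icc 1 N) :
    ∑ y : X × A, occ p μ₀ ρ n y * Real.log (mdStep N p τ π g n y.1 y.2 / π n y.1 y.2) =
      τ * (- pairing (g n) (occ p μ₀ ρ n) +
        (∑ y, occ p μ₀ ρ (n + 1) y * regV N p τ π g (n + 1) y.1 -
          ∑ y, occ p μ₀ ρ n y * regV N p τ π g n y.1)) := by
  obtain ⟨h1, h2⟩ := Finset.mem_Icc.1 hn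
  have e : ∀ y : X × A, occ p μ₀ ρ n y * Real.log (mdStep N p τ π g n y.1 y.2 / π n y.1 y.2) =
      τ * (- (g n y * occ p μ₀ ρ n y) + (occ p μ₀ ρ n y *
        ∑ x', p (n + 1) y.1 y.2 x' * regV N p τ π g (n + 1) x' -
        occ p μ₀ ρ n y * regV N p τ π g n y.1)) := by
    rintro ⟨x, a⟩
    by_cases h : occ p μ₀ ρ n (x, a) = 0
    · simp [h]
    have hl := log_tilt_div (hπ.isPolicy n hn x) (fun a => τ * regQ N p τ π g n x a)
      (hπ.ne_zero_of_occ_ne_zero ρ hρ n hn x a h a)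
    have hq := regQ_eq (g := g) hp hπ.isPolicy hτ h1 h2 (x := x) (a := a)
      fun hlt x' hx' => hπ.ne_zero_of_transition hp hμ₀ hρ hlt h hx'
    have hV : τ * regV N p τ π g n x =
        Real.log (∑ a, π n x a * Real.exp (τ * regQ N p τ π g n x a)) := by
      rw [regV, if_pos h2]
      field_simp
    rw [← hV] at hl
    rw [mdStep, hl, hq]
    ring
  simp_rw [e]
  rw [← Finset.mul_sum, Finset.sum_add_distrib, Finset.sum_sub_distrib, Finset.sum_neg_distrib,
    pairing_apply]
  congr 3
  rcases h2.eq_or_lt with rfl | hlt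
  · simp [regV]
  · rw [sum_occ_succ hρ hlt]

/-- The difference of the regularizers is linear in the state-action distribution, up to a term
that does not depend on the policy. -/
lemma Gam_sub_Gam_mdStep (hp : IsKernel N p) (hμ₀ : μ₀ ∈ stdSimplex ℝ (X × A)) (hN : 1 ≤ N)
    (hπ : IsExploring N p μ₀ π) (hτ : 0 < τ) {ρ : ℕ → X → A → ℝ} (hρ : IsPolicy N ρ) :
    Gam N p μ₀ ρ π - Gam N p μ₀ ρ (mdStep N p τ π g) =
      τ * (- ∑ n ∈ Finset.Icc 1 N, pairing (g n) (occ p μ₀ ρ n) -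
        ∑ z, μ₀ z * ∑ x', p 1 z.1 z.2 x' * regV N p τ π g 1 x') := by
  have e : Gam N p μ₀ ρ π - Gam N p μ₀ ρ (mdStep N p τ π g) =
      ∑ n ∈ Finset.Icc 1 N, ∑ y : X × A,
        occ p μ₀ ρ n y * Real.log (mdStep N p τ π g n y.1 y.2 / π n y.1 y.2) := by
    rw [Gam_eq, Gam_eq, ← Finset.sum_sub_distrib]
    refine Finset.sum_congr rfl fun n hn => ?_
    rw [← Finset.sum_sub_distrib]
    refine Finset.sum_congr rfl fun y _ => ?_
    by_cases h : occ p μ₀ ρ n y = 0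
    · simp [h]
    have h1 := hπ.policy_ne_zero hρ n hn y h
    have h2 : mdStep N p τ π g n y.1 y.2 ≠ 0 := mdStep_ne_zero hπ.isPolicy hn h1
    have h3 : ρ n y.1 y.2 ≠ 0 := by
      obtain ⟨m, rfl⟩ : ∃ m, n = m + 1 := ⟨n - 1, by have := Finset.mem_Icc.1 hn; omega⟩
      rw [occ_succ] at h
      exact right_ne_zero_of_mul h
    rw [Real.log_div h3 h1, Real.log_div h3 h2, Real.log_div h2 h1]
    ring
  rw [e, Finset.sum_congr rfl fun n hn => sum_occ_mul_log_mdStep (g := g) hp hμ₀ hπ hτ hρ hn,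
    ← Finset.mul_sum, Finset.sum_add_distrib, Finset.sum_neg_distrib,
    sum_Icc_sub_succ (fun n => ∑ y, occ p μ₀ ρ n y * regV N p τ π g n y.1)]
  have h1 := sum_occ_succ (p := p) (μ₀ := μ₀) hρ (n := 0) (by omega) (regV N p τ π g 1)
  simp only [zero_add, occ] at h1
  -- The boundary term vanishes because `regV` is set to 0 beyond N; `occ` at N + 1 is
  -- unconstrained.
  have h2 : ∑ y, occ p μ₀ ρ (N + 1) y * regV N p τ π g (N + 1) y.1 = 0 := by simp [regV]
  have h3 : ∑ y, occ p μ₀ ρ 1 y * regV N p τ π g 1 y.1 =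
    ∑ z, μ₀ z * ∑ x', p 1 z.1 z.2 x' * regV N p τ π g 1 x' := h1
  rw [h2, h3]
  ring

lemma Gam_self (π : ℕ → X → A → ℝ) : Gam N p μ₀ π π = 0 := by
  simp only [Gam]
  refine Finset.sum_eq_zero fun n _ => Finset.sum_eq_zero fun x _ =>
    Finset.sum_eq_zero fun a _ => ?_
  by_cases h : π n x a = 0 <;> simp [h]

/-- The descent inequality of mirror descent. -/
lemma mul_objective_sub_le (hp : IsKernel N p) (hμ₀ : μ₀ ∈ stdSimplex ℝ (X × A)) (hN : 1 ≤ N)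
    (hπ : IsExploring N p μ₀ π) (hτ : 0 < τ) {f : ℕ → (X × A → ℝ) → ℝ} {ℓ : ℝ} (hℓ : 0 ≤ ℓ)
    (hconv : ∀ n ∈ Finset.Icc 1 N, ConvexOn ℝ (stdSimplex ℝ (X × A)) (f n))
    (hlip : ∀ n ∈ Finset.Icc 1 N, ∀ ν ∈ stdSimplex ℝ (X × A), ∀ ν' ∈ stdSimplex ℝ (X × A),
      |f n ν - f n ν'| ≤ ℓ * l1 (ν - ν'))
    (hg : ∀ n ∈ Finset.Icc 1 N, IsSimplexGradient (f n) (g n) (occ p μ₀ π n))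
    {ρ : ℕ → X → A → ℝ} (hρ : IsPolicy N ρ) :
    τ * (objective N f (occ p μ₀ π) - objective N f (occ p μ₀ ρ)) ≤
      Gam N p μ₀ ρ π - Gam N p μ₀ ρ (mdStep N p τ π g) + τ ^ 2 * (ℓ * N) ^ 2 / 2 := by
  set π' := mdStep N p τ π g with hπ'
  have hP' : IsPolicy N π' := hπ.isPolicy.mdStep
  have e1 := Gam_sub_Gam_mdStep (g := g) hp hμ₀ hN hπ hτ hρ
  -- Taking ρ = π' in the identity evaluates the policy-independent term; with `e1` this is the
  -- three-point identity.
  have e2 := Gam_sub_Gam_mdStep (g := g) hp hμ₀ hN hπ hτ hP'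
  rw [← hπ', Gam_self] at e2
  rw [← hπ'] at e1
  set Γ := Gam N p μ₀ π' π with hΓ
  have hΓ0 : 0 ≤ Γ := Gam_nonneg hp hμ₀ hP' hπ.isPolicy (hπ.policy_ne_zero hP')
  set d := Real.sqrt (2 * Γ) with hd
  have hd2 : d ^ 2 = 2 * Γ := Real.sq_sqrt (by positivity)
  have hmem : ∀ {η : ℕ → X → A → ℝ}, IsPolicy N η → ∀ n ∈ Finset.Icc 1 N,
      occ p μ₀ η n ∈ stdSimplex ℝ (X × A) :=
    fun hη n hn => occ_mem_stdSimplex hp hμ₀ hη (Finset.mem_Icc.1 hn).2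
  have h1 : ∑ n ∈ Finset.Icc 1 N, pairing (g n) (occ p μ₀ ρ n) -
      ∑ n ∈ Finset.Icc 1 N, pairing (g n) (occ p μ₀ π n) ≤
      objective N f (occ p μ₀ ρ) - objective N f (occ p μ₀ π) := by
    rw [objective, objective, ← Finset.sum_sub_distrib, ← Finset.sum_sub_distrib]
    refine Finset.sum_le_sum fun n hn => ?_
    rw [← map_sub]
    exact (hg n hn).le_sub (hconv n hn) (hmem hπ.isPolicy n hn) (hmem hρ n hn)
  have h2 : ∑ n ∈ Finset.Icc 1 N, pairing (g n) (occ p μ₀ π n) -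
      ∑ n ∈ Finset.Icc 1 N, pairing (g n) (occ p μ₀ π' n) ≤ ℓ * N * d := by
    rw [← Finset.sum_sub_distrib]
    refine (Finset.sum_le_card_nsmul _ _ (ℓ * d) fun n hn => ?_).trans (le_of_eq ?_)
    · rw [← map_sub]
      refine ((hg n hn).pairing_le (hlip n hn) (hmem hπ.isPolicy n hn) (hmem hπ.isPolicy n hn)
        (hmem hP' n hn)).trans (mul_le_mul_of_nonneg_left ?_ hℓ)
      have e : l1 (occ p μ₀ π n - occ p μ₀ π' n) = l1 (occ p μ₀ π' n - occ p μ₀ π n) := by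
        simp [l1, abs_sub_comm]
      rw [e]
      exact l1_occ_sub_le hp hμ₀ hP' hπ.isPolicy (hπ.policy_ne_zero hP') (Finset.mem_Icc.1 hn).2
    · simp
      ring
  -- The identity contributes -Γ = -d²/2, which absorbs the Lipschitz error through τLd - d²/2 ≤
  -- τ²L²/2.
  nlinarith [mul_le_mul_of_nonneg_left h1 hτ.le, mul_le_mul_of_nonneg_left h2 hτ.le,
    sq_nonneg (d - τ * (ℓ * N))]

end Step

/-! ### Degenerate case and summation over the iterations -/

/-- Policies at relative entropy zero induce the same state-action distributions. -/
lemma occ_eq_of_Gam_nonpos {X A : Type*} [Fintype X] [Fintype A] {N : ℕ}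
    {p : ℕ → X → A → X → ℝ} {μ₀ : X × A → ℝ} (hp : IsKernel N p)
    (hμ₀ : μ₀ ∈ stdSimplex ℝ (X × A)) {π ρ : ℕ → X → A → ℝ} (hπ : IsExploring N p μ₀ π)
    (hρ : IsPolicy N ρ) (h : Gam N p μ₀ ρ π ≤ 0) {n : ℕ} (hn : n ≤ N) :
    occ p μ₀ ρ n = occ p μ₀ π n := by
  have h1 := l1_occ_sub_le hp hμ₀ hρ hπ.isPolicy (hπ.policy_ne_zero hρ) hn
  rw [Real.sqrt_eq_zero_of_nonpos (by linarith)] at h1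
  have h2 : l1 (occ p μ₀ ρ n - occ p μ₀ π n) = 0 :=
    h1.antisymm (Finset.sum_nonneg fun _ _ => abs_nonneg _)
  ext y
  have := (Finset.sum_eq_zero_iff_of_nonneg fun _ _ => abs_nonneg _).1 h2 y (Finset.mem_univ y)
  exact sub_eq_zero.1 (abs_eq_zero.1 this)

lemma IsExploring.iter {X A : Type*} [Fintype X] [Fintype A] {N : ℕ}
    {p : ℕ → X → A → X → ℝ} {μ₀ : X × A → ℝ} {π : ℕ → X → A → ℝ} (hπ : IsExploring N p μ₀ π)
    (G : ℕ → (X × A → ℝ) → X × A → ℝ) (τ : ℕ → ℝ) :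
    ∀ k, IsExploring N p μ₀ (iter N p μ₀ G τ π k)
  | 0 => hπ
  | k + 1 => (hπ.iter G τ k).mdStep

end MDCURL

theorem theorem2 {X A : Type*} [Fintype X] [Fintype A]
    -- the MDP: horizon, transition kernels, initial state-action distribution
    (N : ℕ) (hN : 1 ≤ N)
    (p : ℕ → X → A → X → ℝ) (hp : MDCURL.IsKernel N p)
    (μ₀ : X × A → ℝ) (hμ₀ : μ₀ ∈ stdSimplex ℝ (X × A))
    -- the objective: convex functions, Lipschitz for the 1-norm, on the simplex
    (f : ℕ → (X × A → ℝ) → ℝ) (ℓ : ℝ) (hℓ : 0 < ℓ)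
    (hconv : ∀ n ∈ Finset.Icc 1 N, ConvexOn ℝ (stdSimplex ℝ (X × A)) (f n))
    (hlip : ∀ n ∈ Finset.Icc 1 N, ∀ ν ∈ stdSimplex ℝ (X × A), ∀ ν' ∈ stdSimplex ℝ (X × A),
      |f n ν - f n ν'| ≤ ℓ * MDCURL.l1 (ν - ν'))
    -- a minimizer of the problem over all policies
    (πs : ℕ → X → A → ℝ) (hπs : MDCURL.IsPolicy N πs)
    (hmin : ∀ π : ℕ → X → A → ℝ, MDCURL.IsPolicy N π →
      MDCURL.objective N f (MDCURL.occ p μ₀ πs) ≤ MDCURL.objective N f (MDCURL.occ p μ₀ π))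
    -- the initial policy of the algorithm
    (π₀ : ℕ → X → A → ℝ) (hπ₀ : MDCURL.IsPolicy N π₀)
    (hpos : MDCURL.occ p μ₀ π₀ ∈ MDCURL.flowSetPos N p μ₀)
    -- the number of iterations and the step sizes
    (K : ℕ) (hK : 1 ≤ K) (L : ℝ) (hL : L = ℓ * N)
    (τ : ℕ → ℝ)
    (hτ : ∀ k < K, τ k = L⁻¹ * Real.sqrt (2 * MDCURL.Gam N p μ₀ πs π₀ / K))
    -- the gradients which the algorithm evaluates are those of the functions `f n`
    (G : ℕ → (X × A → ℝ) → X × A → ℝ)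
    (hG : ∀ k < K, ∀ n ∈ Finset.Icc 1 N,
      MDCURL.IsSimplexGradient (f n)
        (G n (MDCURL.occ p μ₀ (MDCURL.iter N p μ₀ G τ π₀ k) n))
        (MDCURL.occ p μ₀ (MDCURL.iter N p μ₀ G τ π₀ k) n)) :
    (Finset.range (K + 1)).inf' Finset.nonempty_range_add_one
        (fun k => MDCURL.objective N f (MDCURL.occ p μ₀ (MDCURL.iter N p μ₀ G τ π₀ k)))
      - MDCURL.objective N f (MDCURL.occ p μ₀ πs)
      ≤ L * (Real.sqrt (2 * MDCURL.Gam N p μ₀ πs π₀) / Real.sqrt K) := by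
  have hE := MDCURL.isExploring_of_mem_flowSetPos hp hμ₀ hπ₀ hpos
  have hLpos : 0 < L := by
    rw [hL]
    have : (0 : ℝ) < N := by exact_mod_cast hN
    positivity
  have hKpos : (0 : ℝ) < K := by exact_mod_cast hK
  set Γ := MDCURL.Gam N p μ₀ πs π₀ with hΓ
  set F : ℕ → ℝ := fun k => MDCURL.objective N f (MDCURL.occ p μ₀ (MDCURL.iter N p μ₀ G τ π₀ k))
    with hF
  set m := (Finset.range (K + 1)).inf' Finset.nonempty_range_add_one F with hm
  have hmle : ∀ k ≤ K, m ≤ F k := fun k hk =>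
    Finset.inf'_le _ (Finset.mem_range.2 (by omega))
  rcases (MDCURL.Gam_nonneg hp hμ₀ hπs hπ₀ (hE.policy_ne_zero hπs)).eq_or_lt with h0 | hΓpos
  -- Zero divergence makes the initial distributions equal to those of π*, so k = 0 already attains
  -- the bound.
  · have hF0 : F 0 = MDCURL.objective N f (MDCURL.occ p μ₀ πs) :=
      Finset.sum_congr rfl fun n hn => by
        rw [MDCURL.occ_eq_of_Gam_nonpos hp hμ₀ hE hπs h0.symm.le (Finset.mem_Icc.1 hn).2]
        rfl
    have h1 := hmle 0 (by omega)
    have h2 : 0 ≤ L * (Real.sqrt (2 * Γ) / Real.sqrt K) := by positivity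
    linarith
  · set t := L⁻¹ * Real.sqrt (2 * Γ / K) with ht
    have htpos : 0 < t := by
      have : 0 < 2 * Γ / K := by positivity
      positivity
    have hstep : ∀ k < K, t * (m - MDCURL.objective N f (MDCURL.occ p μ₀ πs)) ≤
        MDCURL.Gam N p μ₀ πs (MDCURL.iter N p μ₀ G τ π₀ k) -
          MDCURL.Gam N p μ₀ πs (MDCURL.iter N p μ₀ G τ π₀ (k + 1)) + t ^ 2 * L ^ 2 / 2 := by
      intro k hk
      have h := MDCURL.mul_objective_sub_le hp hμ₀ hN (hE.iter G τ k) htpos hℓ.le hconv hlip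
        (hG k hk) hπs
      rw [← hL] at h
      rw [MDCURL.iter, hτ k hk]
      refine le_trans ?_ h
      have := hmle k hk.le
      gcongr
    have hsum := Finset.sum_le_sum fun k hk => hstep k (Finset.mem_range.1 hk)
    rw [Finset.sum_add_distrib, Finset.sum_range_sub'
      (fun k => MDCURL.Gam N p μ₀ πs (MDCURL.iter N p μ₀ G τ π₀ k))] at hsum
    simp only [Finset.sum_const, Finset.card_range, nsmul_eq_mul] at hsum
    have hlast := MDCURL.Gam_nonneg hp hμ₀ hπs (hE.iter G τ K).isPolicy
      ((hE.iter G τ K).policy_ne_zero hπs)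
    have hfirst : MDCURL.Gam N p μ₀ πs (MDCURL.iter N p μ₀ G τ π₀ 0) = Γ := rfl
    rw [hfirst] at hsum
    have hLt : L * t = Real.sqrt (2 * Γ / K) := by rw [ht, mul_inv_cancel_left₀ hLpos.ne']
    -- The balance behind the step size: Γ/(Kt) and tL²/2 coincide, and their sum is L · (Lt).
    have hsq : (L * t) ^ 2 * K = 2 * Γ := by
      rw [hLt, Real.sq_sqrt (by positivity)]
      field_simp
    rw [← Real.sqrt_div (by positivity), ← hLt]
    have hKt : 0 < K * t := by positivity
    refine le_of_mul_le_mul_left ?_ hKt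
    nlinarith
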